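/- Let $\mathcal H$ be a complex Hilbert space and let $T\neq 0$ be a bounded linear operator on $\mathcal H$. For a bounded operator $S$ on a Hilbert space put $\Delta_S=S^*S-I$; $S$ is a *2-isometry* if $S^*\Delta_S S=\Delta_S$. A *lifting* of $T$ is a bounded operator $S$ on a Hilbert space $\mathcal K$ containing $\mathcal H$ as a closed subspace such that $P S=T P$, where $P:\mathcal K\to\mathcal H$ is the orthogonal projection. A *2-isometric lifting of type I* of $T$ is a lifting $S$ of $T$ that is a 2-isometry and satisfies $\mathcal K\ominus\mathcal H\subset\ker\Delta_S$. An operator $A$ is *positive* if $\langle Ah,h\rangle\ge 0$ for all $h\in\mathcal H$ (so $0$ is positive), and $A\le B$ means that $B-A$ is positive. Then $T$ has a 2-isometric lifting of type I (on some Hilbert space containing $\mathcal H$) if and only if there exist positive bounded operators $A$ and $Q$ on $\mathcal H$ such that $$\Delta_T\le A\qquad\text{and}\qquad T^*AT\le A\le Q\le T^*QT .$$ -/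

import Mathlib

universe u v

section Liftings

variable {H : Type u} [NormedAddCommGroup H] [InnerProductSpace ℂ H] [CompleteSpace H]
variable {K : Type v} [NormedAddCommGroup K] [InnerProductSpace ℂ K] [CompleteSpace K]

/-- The operator `Δ_T = T* T - I`. -/
noncomputable def deltaOp (T : H →L[ℂ] H) : H →L[ℂ] H :=
  ContinuousLinearMap.adjoint T * T - 1

/-- `T` is a 2-isometry: `T* Δ_T T = Δ_T`. -/
def IsTwoIsometry (T : H →L[ℂ] H) : Prop :=
  ContinuousLinearMap.adjoint T * deltaOp T * T = deltaOp T

/-- `S` on `K` is a lifting of `T` on `H`, where `H` is regarded as a closed subspace of the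
Hilbert space `K` through the isometric embedding `J`. The adjoint `P = J*` is then the projection
of `K` onto `H`, and the condition is `P S = T P`. -/
def IsLifting (J : H →ₗᵢ[ℂ] K) (T : H →L[ℂ] H) (S : K →L[ℂ] K) : Prop :=
  ContinuousLinearMap.adjoint J.toContinuousLinearMap ∘L S =
    T ∘L ContinuousLinearMap.adjoint J.toContinuousLinearMap

/-- `S` is a 2-isometric lifting of type I of `T`: `S` is a 2-isometry, `S` is a lifting of `T`,
and the orthogonal complement of `H` in `K` is contained in the kernel of `Δ_S`. -/
structure IsTwoIsometricLiftingTypeI (J : H →ₗᵢ[ℂ] K) (T : H →L[ℂ] H) (S : K →L[ℂ] K) :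
    Prop where
  isTwoIsometry : IsTwoIsometry S
  isLifting : IsLifting J T S
  typeI : (LinearMap.range J.toLinearMap)ᗮ ≤ LinearMap.ker (deltaOp S).toLinearMap

/-- `T` has a 2-isometric lifting of type I on some Hilbert space containing `H`. -/
def HasTwoIsometricLiftingTypeI (T : H →L[ℂ] H) : Prop :=
  ∃ (K : Type u) (_ : NormedAddCommGroup K) (_ : InnerProductSpace ℂ K) (_ : CompleteSpace K)
    (J : H →ₗᵢ[ℂ] K) (S : K →L[ℂ] K), IsTwoIsometricLiftingTypeI J T S

end Liftings

/-! Both conditions amount to a positive `Y ≥ Δ_T` with `T* Y T = Y`. For a type I lifting `S`,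
`Δ_S` lives only on `H`, so its compression to `H` is such a `Y`; it is positive because
2-isometries are expansive (`IsTwoIsometry.deltaOp_nonneg`). Conversely, write `Y - Δ_T = X* X` and
let `S` send `(x₀, x₁, …)` to `(T x₀, X x₀, x₁, …)`: then `Δ_S = Y ⊕ 0` (`inner_deltaOp_liftOp`). To
get `Y` from `A ≤ Q`, iterating `B ↦ T* B T` from `A` goes down and may lose `Δ_T ≤ A`. Instead `T*
B' T = B` is solved repeatedly with `B ≤ B' ≤ Q`, using Douglas' lemma; the increasing bounded
sequence has a weak limit, which is fixed. -/

open scoped ComplexOrder InnerProductSpace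
open Filter Topology
open ContinuousLinearMap (adjoint)

namespace ContinuousLinearMap

/-! ### Operator order, factorization and fixed points. -/

section Operators

variable {H : Type*} [NormedAddCommGroup H] [InnerProductSpace ℂ H]

theorem le_iff_inner_le {f g : H →L[ℂ] H} : f ≤ g ↔ ∀ x, ⟪f x, x⟫_ℂ ≤ ⟪g x, x⟫_ℂ := by
  rw [le_def, isPositive_iff_complex]
  refine forall_congr' fun x => ?_
  rw [sub_apply, inner_sub_left, ← sub_nonneg (a := ⟪g x, x⟫_ℂ), Complex.nonneg_iff,
    Complex.ext_iff, and_comm]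
  simp

variable [CompleteSpace H]

theorem inner_star_mul_mul_apply (a b c : H →L[ℂ] H) (x y : H) :
    ⟪(star a * b * c) x, y⟫_ℂ = ⟪b (c x), a y⟫_ℂ := by
  rw [star_eq_adjoint]
  exact adjoint_inner_left a y (b (c x))

theorem inner_star_mul_self_apply (a : H →L[ℂ] H) (x y : H) :
    ⟪(star a * a) x, y⟫_ℂ = ⟪a x, a y⟫_ℂ := by
  rw [star_eq_adjoint]
  exact adjoint_inner_left a y (a x)

theorem norm_apply_le_of_star_mul_self_le {a b : H →L[ℂ] H} (h : star a * a ≤ star b * b)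
    (x : H) : ‖a x‖ ≤ ‖b x‖ := by
  have := le_iff_inner_le.1 h x
  rw [inner_star_mul_self_apply, inner_star_mul_self_apply, inner_self_eq_norm_sq_to_K,
    inner_self_eq_norm_sq_to_K] at this
  exact (sq_le_sq₀ (norm_nonneg _) (norm_nonneg _)).1 (by exact_mod_cast this)

theorem star_mul_self_le_one_of_norm_apply_le {w : H →L[ℂ] H} (h : ∀ x, ‖w x‖ ≤ ‖x‖) :
    star w * w ≤ 1 := by
  rw [le_iff_inner_le]
  intro x
  rw [inner_star_mul_self_apply, _root_.one_apply_eq_self, inner_self_eq_norm_sq_to_K,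
    inner_self_eq_norm_sq_to_K]
  exact_mod_cast (sq_le_sq₀ (norm_nonneg _) (norm_nonneg _)).2 (h x)

/-- Douglas' factorization lemma. -/
theorem exists_mul_eq_of_star_mul_self_le {a b : H →L[ℂ] H} (h : star a * a ≤ star b * b) :
    ∃ w : H →L[ℂ] H, w * b = a ∧ star w * w ≤ 1 := by
  let M := b.range.topologicalClosure
  have : CompleteSpace M := b.range.isClosed_topologicalClosure.completeSpace_coe
  have hM : ∀ x, b x ∈ M := fun x => b.range.le_topologicalClosure ⟨x, rfl⟩
  let e : H →ₗ[ℂ] M := b.toLinearMap.codRestrict M hM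
  have he : DenseRange e := by
    intro y
    rw [closure_subtype]
    have hy : (y : H) ∈ closure (b.range : Set H) := y.2
    refine closure_mono ?_ hy
    rintro _ ⟨x, rfl⟩
    exact ⟨e x, ⟨x, rfl⟩, rfl⟩
  have hn : ∀ x, ‖a.toLinearMap x‖ ≤ 1 * ‖e x‖ := fun x => by
    rw [one_mul]
    exact norm_apply_le_of_star_mul_self_le h x
  -- The contraction `b x ↦ a x`, extended by continuity to the closure of the range of `b` and by
  -- zero to its complement.
  let f := a.toLinearMap.extendOfNorm e
  refine ⟨f ∘L M.orthogonalProjectionOnto, ?_, ?_⟩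
  · ext x
    have : M.orthogonalProjectionOnto (b x) = e x :=
      M.orthogonalProjectionOnto_mem_subspace_eq_self (e x)
    change f (M.orthogonalProjectionOnto (b x)) = a x
    rw [this]
    exact LinearMap.extendOfNorm_eq he ⟨1, hn⟩ x
  · refine star_mul_self_le_one_of_norm_apply_le fun x => ?_
    refine (LinearMap.norm_extendOfNorm_apply_le he 1 hn _).trans ?_
    rw [one_mul]
    exact M.norm_orthogonalProjectionOnto_apply_le x

/-- With `D = d* d` and `R = r* r`, Douglas gives `d = w r T` for a contraction `w`; take `G = (w
r)* (w r)`. -/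
theorem exists_star_mul_mul_eq_of_le {D R T : H →L[ℂ] H} (hD : 0 ≤ D) (hR : 0 ≤ R)
    (h : D ≤ star T * R * T) : ∃ G, 0 ≤ G ∧ G ≤ R ∧ star T * G * T = D := by
  obtain ⟨d, rfl⟩ := CStarAlgebra.nonneg_iff_eq_star_mul_self.1 hD
  obtain ⟨r, rfl⟩ := CStarAlgebra.nonneg_iff_eq_star_mul_self.1 hR
  obtain ⟨w, hw, hw1⟩ := exists_mul_eq_of_star_mul_self_le (a := d) (b := r * T)
    (by simpa only [star_mul, mul_assoc] using h)
  refine ⟨star (w * r) * (w * r), star_mul_self_nonneg _, ?_, ?_⟩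
  · simpa only [star_mul, mul_assoc, one_mul] using star_left_conjugate_le_conjugate hw1 r
  · simp only [← hw, star_mul, mul_assoc]

theorem exists_le_star_mul_mul_eq {B Q T : H →L[ℂ] H} (hB : star T * B * T ≤ B) (hBQ : B ≤ Q)
    (hQ : Q ≤ star T * Q * T) : ∃ B', B ≤ B' ∧ B' ≤ Q ∧ star T * B' * T = B := by
  -- `B' = B + G`, where `G ≤ Q - B` solves `T* G T = B - T* B T`.
  obtain ⟨G, hG, hGR, hGT⟩ := exists_star_mul_mul_eq_of_le (T := T) (sub_nonneg.2 hB)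
    (sub_nonneg.2 hBQ) (by
      rw [mul_sub, sub_mul]
      exact sub_le_sub_right (hBQ.trans hQ) _)
  refine ⟨B + G, le_add_of_nonneg_right hG, ?_, ?_⟩
  · simpa using add_le_add_right hGR B
  · rw [mul_add, add_mul, hGT, add_sub_cancel]

/-- Weak compactness of balls: limits along an ultrafilter exist for all pairs at once, hence are
sesquilinear. -/
theorem exists_tendsto_inner_of_norm_le {ι : Type*} (u : Ultrafilter ι) (F : ι → H →L[ℂ] H)
    {C : ℝ} (hF : ∀ i, ‖F i‖ ≤ C) :
    ∃ X : H →L[ℂ] H, ∀ x y, Tendsto (fun i => ⟪F i x, y⟫_ℂ) u (𝓝 ⟪X x, y⟫_ℂ) := by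
  have hb : ∀ x y i, ‖⟪F i x, y⟫_ℂ‖ ≤ C * ‖x‖ * ‖y‖ := fun x y i =>
    (norm_inner_le_norm _ _).trans
      (mul_le_mul_of_nonneg_right ((F i).le_of_opNorm_le (hF i) x) (norm_nonneg y))
  have hex : ∀ x y, ∃ z : ℂ, ‖z‖ ≤ C * ‖x‖ * ‖y‖ ∧ Tendsto (fun i => ⟪F i x, y⟫_ℂ) u (𝓝 z) := by
    intro x y
    obtain ⟨z, hz, hzu⟩ := (isCompact_closedBall (0 : ℂ) (C * ‖x‖ * ‖y‖)).ultrafilter_le_nhds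
      (u.map fun i => ⟪F i x, y⟫_ℂ)
      (le_principal_iff.2 (Filter.mem_map.2 (univ_mem' fun i => by simpa using hb x y i)))
    exact ⟨z, by simpa using hz, hzu⟩
  choose Z hZ hZu using hex
  let B : H →ₗ⋆[ℂ] H →ₗ[ℂ] ℂ := LinearMap.mk₂'ₛₗ (starRingEnd ℂ) (RingHom.id ℂ) Z
    (fun x x' y => tendsto_nhds_unique (hZu _ _) (by
      simpa only [map_add, inner_add_left] using (hZu x y).add (hZu x' y)))
    (fun c x y => tendsto_nhds_unique (hZu _ _) (by
      simpa only [map_smul, inner_smul_left, smul_eq_mul] using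
        (hZu x y).const_mul (starRingEnd ℂ c)))
    (fun x y y' => tendsto_nhds_unique (hZu _ _) (by
      simpa only [inner_add_right] using (hZu x y).add (hZu x y')))
    (fun c x y => tendsto_nhds_unique (hZu _ _) (by
      simpa only [inner_smul_right, smul_eq_mul, RingHom.id_apply] using (hZu x y).const_mul c))
  refine ⟨InnerProductSpace.continuousLinearMapOfBilin (B.mkContinuous₂ C hZ), fun x y => ?_⟩
  rw [InnerProductSpace.continuousLinearMapOfBilin_apply]
  exact hZu x y

/-- If `A` is decreased and `Q ≥ A` is increased by `X ↦ T* X T`, then this map has a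
fixed point above `A`. -/
theorem exists_le_star_mul_mul_eq_self {A Q T : H →L[ℂ] H} (hA : 0 ≤ A)
    (hAT : star T * A * T ≤ A) (hAQ : A ≤ Q) (hQ : Q ≤ star T * Q * T) :
    ∃ X, A ≤ X ∧ star T * X * T = X := by
  let P : Type _ := {B : H →L[ℂ] H // A ≤ B ∧ star T * B * T ≤ B ∧ B ≤ Q}
  have hstep : ∀ B : P, ∃ B' : P, star T * B'.1 * T = B.1 := by
    rintro ⟨B, hAB, hBT, hBQ⟩
    obtain ⟨B', h1, h2, h3⟩ := exists_le_star_mul_mul_eq hBT hBQ hQ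
    exact ⟨⟨B', hAB.trans h1, h3.le.trans h1, h2⟩, h3⟩
  choose s hs using hstep
  let F : ℕ → P := fun n => s^[n] ⟨A, le_rfl, hAT, hAQ⟩
  have hF : ∀ n, star T * (F (n + 1)).1 * T = (F n).1 := fun n => by
    simp only [F, Function.iterate_succ_apply']
    exact hs _
  have hmono : Monotone fun n => (F n).1 := monotone_nat_of_le_succ fun n => by
    rw [← hF n]
    exact (F (n + 1)).2.2.1
  obtain ⟨X, hX⟩ := exists_tendsto_inner_of_norm_le (hyperfilter ℕ) (fun n => (F n).1)
    (C := ‖Q‖) fun n =>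
      CStarAlgebra.norm_le_norm_of_nonneg_of_le (hA.trans (F n).2.1) (F n).2.2.2
  have hle : ∀ n, (F n).1 ≤ X := fun n => le_iff_inner_le.2 fun x =>
    ge_of_tendsto (hX x x) <| Nat.hyperfilter_le_atTop <| (eventually_ge_atTop n).mono fun m hm =>
      le_iff_inner_le.1 (hmono hm) x
  -- Pass to the limit in `T* Fₙ T ≤ Fₙ ≤ X` and in `Fₙ = T* Fₙ₊₁ T ≤ T* X T`.
  refine ⟨X, (F 0).2.1.trans (hle 0), le_antisymm ?_ ?_⟩
  · refine le_iff_inner_le.2 fun x => ?_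
    rw [inner_star_mul_mul_apply]
    refine le_of_tendsto (hX (T x) (T x)) (Eventually.of_forall fun n => ?_)
    rw [← inner_star_mul_mul_apply]
    exact le_iff_inner_le.1 ((F n).2.2.1.trans (hle n)) x
  · refine le_iff_inner_le.2 fun x => le_of_tendsto (hX x x) (Eventually.of_forall fun n => ?_)
    rw [← hF n]
    exact le_iff_inner_le.1 (star_left_conjugate_le_conjugate (hle (n + 1)) T) x

end Operators

end ContinuousLinearMap

/-! ### 2-isometries are expansive. -/

section TwoIsometries

variable {K : Type*} [NormedAddCommGroup K] [InnerProductSpace ℂ K] [CompleteSpace K]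

theorem inner_deltaOp_apply (S : K →L[ℂ] K) (x y : K) :
    ⟪deltaOp S x, y⟫_ℂ = ⟪S x, S y⟫_ℂ - ⟪x, y⟫_ℂ := by
  change ⟪adjoint S (S x) - x, y⟫_ℂ = _
  rw [inner_sub_left, ContinuousLinearMap.adjoint_inner_left]

theorem inner_deltaOp_apply_self (S : K →L[ℂ] K) (x : K) :
    ⟪deltaOp S x, x⟫_ℂ = ((‖S x‖ ^ 2 - ‖x‖ ^ 2 : ℝ) : ℂ) := by
  rw [inner_deltaOp_apply, inner_self_eq_norm_sq_to_K, inner_self_eq_norm_sq_to_K]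
  push_cast
  rfl

theorem isSelfAdjoint_deltaOp (S : K →L[ℂ] K) : IsSelfAdjoint (deltaOp S) :=
  (IsSelfAdjoint.star_mul_self S).sub (IsSelfAdjoint.one _)

theorem IsTwoIsometry.norm_sq_sub_norm_sq {S : K →L[ℂ] K} (hS : IsTwoIsometry S) (x : K) :
    ‖S (S x)‖ ^ 2 - ‖S x‖ ^ 2 = ‖S x‖ ^ 2 - ‖x‖ ^ 2 := by
  have h : ⟪(adjoint S * deltaOp S * S) x, x⟫_ℂ = ⟪deltaOp S x, x⟫_ℂ := by
    rw [hS]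
  have h' := ContinuousLinearMap.inner_star_mul_mul_apply S (deltaOp S) S x x
  rw [ContinuousLinearMap.star_eq_adjoint, h, inner_deltaOp_apply_self,
    inner_deltaOp_apply_self] at h'
  exact_mod_cast h'.symm

theorem IsTwoIsometry.norm_iterate_sq {S : K →L[ℂ] K} (hS : IsTwoIsometry S) (n : ℕ) (x : K) :
    ‖S^[n] x‖ ^ 2 = ‖x‖ ^ 2 + n * (‖S x‖ ^ 2 - ‖x‖ ^ 2) := by
  induction n generalizing x with
  | zero => simp
  | succ n ih =>
    rw [Function.iterate_succ_apply, ih, hS.norm_sq_sub_norm_sq]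
    push_cast
    ring

/-- `‖Sⁿ x‖²` is affine in `n`; a negative slope would eventually make it negative. -/
theorem IsTwoIsometry.deltaOp_nonneg {S : K →L[ℂ] K} (hS : IsTwoIsometry S) :
    0 ≤ deltaOp S := by
  rw [ContinuousLinearMap.le_iff_inner_le]
  intro x
  rw [inner_deltaOp_apply_self, zero_apply, inner_zero_left]
  norm_cast
  by_contra! hneg
  obtain ⟨n, hn⟩ := exists_nat_gt (‖x‖ ^ 2 / (‖x‖ ^ 2 - ‖S x‖ ^ 2))
  rw [div_lt_iff₀ (by linarith)] at hn
  have := hS.norm_iterate_sq n x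
  nlinarith [sq_nonneg ‖S^[n] x‖]

end TwoIsometries

/-! ### From a lifting to a fixed point. -/

section Compression

variable {H K : Type*} [NormedAddCommGroup H] [InnerProductSpace ℂ H] [CompleteSpace H]
  [NormedAddCommGroup K] [InnerProductSpace ℂ K] [CompleteSpace K]
  {J : H →ₗᵢ[ℂ] K} {T : H →L[ℂ] H} {S : K →L[ℂ] K}

theorem LinearIsometry.adjoint_apply_apply (J : H →ₗᵢ[ℂ] K) (x : H) : adjoint J.toContinuousLinearMap (J x) = x :=
  ext_inner_right ℂ fun y => by
    rw [ContinuousLinearMap.adjoint_inner_left]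
    exact J.inner_map_map x y

theorem LinearIsometry.sub_apply_adjoint_mem_orthogonal (J : H →ₗᵢ[ℂ] K) (x : K) :
    x - J (adjoint J.toContinuousLinearMap x) ∈ (LinearMap.range J.toLinearMap)ᗮ := by
  rw [Submodule.mem_orthogonal']
  rintro _ ⟨y, rfl⟩
  have : ⟪adjoint J.toContinuousLinearMap x, y⟫_ℂ = ⟪x, J y⟫_ℂ := ContinuousLinearMap.adjoint_inner_left _ _ _
  change ⟪x - J (adjoint J.toContinuousLinearMap x), J y⟫_ℂ = 0
  rw [inner_sub_left, J.inner_map_map, this, sub_self]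

theorem IsLifting.adjoint_apply (h : IsLifting J T S) (x : K) : adjoint J.toContinuousLinearMap (S x) = T (adjoint J.toContinuousLinearMap x) :=
  DFunLike.congr_fun h x

theorem IsTwoIsometricLiftingTypeI.deltaOp_apply (h : IsTwoIsometricLiftingTypeI J T S) (x : K) :
    deltaOp S x = deltaOp S (J (adjoint J.toContinuousLinearMap x)) := by
  have := h.typeI (J.sub_apply_adjoint_mem_orthogonal x)
  rw [LinearMap.mem_ker] at this
  exact sub_eq_zero.1 ((map_sub (deltaOp S) _ _).symm.trans this)

theorem IsTwoIsometricLiftingTypeI.inner_deltaOp (h : IsTwoIsometricLiftingTypeI J T S)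
    (x y : K) : ⟪deltaOp S x, y⟫_ℂ = ⟪deltaOp S (J (adjoint J.toContinuousLinearMap x)), J (adjoint J.toContinuousLinearMap y)⟫_ℂ := by
  have hs : ∀ x y, ⟪deltaOp S x, y⟫_ℂ = ⟪x, deltaOp S y⟫_ℂ :=
    fun x y => (isSelfAdjoint_deltaOp S).isSymmetric x y
  rw [h.deltaOp_apply, hs, h.deltaOp_apply y, ← hs]

theorem IsTwoIsometricLiftingTypeI.exists_fixed (h : IsTwoIsometricLiftingTypeI J T S) :
    ∃ A : H →L[ℂ] H, 0 ≤ A ∧ deltaOp T ≤ A ∧ star T * A * T = A := by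
  let A : H →L[ℂ] H := adjoint J.toContinuousLinearMap ∘L deltaOp S ∘L J.toContinuousLinearMap
  have hA : ∀ x y, ⟪A x, y⟫_ℂ = ⟪deltaOp S (J x), J y⟫_ℂ := fun x y =>
    ContinuousLinearMap.adjoint_inner_left J.toContinuousLinearMap y (deltaOp S (J x))
  have hJS : ∀ x, adjoint J.toContinuousLinearMap (S (J x)) = T x := fun x => by
    rw [h.isLifting.adjoint_apply, J.adjoint_apply_apply]
  refine ⟨A, ?_, ?_, ?_⟩
  · rw [ContinuousLinearMap.le_iff_inner_le]
    intro x
    rw [hA]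
    have := ContinuousLinearMap.le_iff_inner_le.1 h.isTwoIsometry.deltaOp_nonneg (J x)
    rw [zero_apply, inner_zero_left] at this ⊢
    exact this
  · rw [ContinuousLinearMap.le_iff_inner_le]
    intro x
    rw [hA, inner_deltaOp_apply_self, inner_deltaOp_apply_self, J.norm_map]
    -- `T = J* S J` and `J*` is a contraction.
    have : ‖T x‖ ≤ ‖S (J x)‖ := by
      have hn := (adjoint J.toContinuousLinearMap).le_opNorm (S (J x))
      rw [hJS, LinearIsometryEquiv.norm_map] at hn
      exact hn.trans (mul_le_of_le_one_left (norm_nonneg _) J.norm_toContinuousLinearMap_le)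
    norm_cast
    gcongr
  · refine ContinuousLinearMap.ext fun x => ext_inner_right ℂ fun y => ?_
    rw [ContinuousLinearMap.inner_star_mul_mul_apply, hA, hA, ← hJS, ← hJS, ← h.inner_deltaOp,
      ← ContinuousLinearMap.inner_star_mul_mul_apply, ContinuousLinearMap.star_eq_adjoint,
      h.isTwoIsometry]

end Compression

/-! ### From a fixed point to a lifting. -/

section Construction

variable {H : Type u} [NormedAddCommGroup H] [InnerProductSpace ℂ H]

/-- The sequence `(T x₀, X x₀, x₁, x₂, …)`. -/
def liftSeq (T X : H →L[ℂ] H) (x : ℕ → H) : ℕ → H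
  | 0 => T (x 0)
  | 1 => X (x 0)
  | n + 2 => x (n + 1)

theorem memℓp_liftSeq (T X : H →L[ℂ] H) (x : lp (fun _ : ℕ => H) 2) :
    Memℓp (liftSeq T X x) 2 := by
  have hx := lp.memℓp x
  rw [memℓp_gen_iff (by norm_num)] at hx ⊢
  rw [← summable_nat_add_iff 2]
  exact (summable_nat_add_iff 1).2 hx

theorem inner_liftSeq (T X : H →L[ℂ] H) (x y : lp (fun _ : ℕ => H) 2) :
    ⟪(⟨liftSeq T X x, memℓp_liftSeq T X x⟩ : lp (fun _ : ℕ => H) 2),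
      ⟨liftSeq T X y, memℓp_liftSeq T X y⟩⟫_ℂ =
      ⟪x, y⟫_ℂ + ⟪T (x 0), T (y 0)⟫_ℂ + ⟪X (x 0), X (y 0)⟫_ℂ - ⟪x 0, y 0⟫_ℂ := by
  have h1 := lp.hasSum_inner (𝕜 := ℂ) (⟨liftSeq T X x, memℓp_liftSeq T X x⟩ :
    lp (fun _ : ℕ => H) 2) ⟨liftSeq T X y, memℓp_liftSeq T X y⟩
  have h2 := lp.hasSum_inner (𝕜 := ℂ) x y
  -- The sequences agree from index 2 of the lift and index 1 of the original on.
  rw [← hasSum_nat_add_iff' 2] at h1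
  rw [← hasSum_nat_add_iff' 1] at h2
  have := h1.unique h2
  simp only [Finset.sum_range_succ, Finset.sum_range_zero, liftSeq] at this
  linear_combination this

theorem norm_liftSeq_sq (T X : H →L[ℂ] H) (x : lp (fun _ : ℕ => H) 2) :
    ‖(⟨liftSeq T X x, memℓp_liftSeq T X x⟩ : lp (fun _ : ℕ => H) 2)‖ ^ 2 =
      ‖x‖ ^ 2 + ‖T (x 0)‖ ^ 2 + ‖X (x 0)‖ ^ 2 - ‖x 0‖ ^ 2 := by
  have := inner_liftSeq T X x x
  simp only [inner_self_eq_norm_sq_to_K] at this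
  exact_mod_cast this

/-- The operator `x ↦ (T x₀, X x₀, x₁, x₂, …)` on `ℓ²(ℕ, H)`. -/
noncomputable def liftOp (T X : H →L[ℂ] H) :
    lp (fun _ : ℕ => H) 2 →L[ℂ] lp (fun _ : ℕ => H) 2 :=
  LinearMap.mkContinuous
    { toFun := fun x => ⟨liftSeq T X x, memℓp_liftSeq T X x⟩
      map_add' := fun x y => by
        ext n
        rcases n with _ | _ | n
        exacts [map_add T _ _, map_add X _ _, rfl]
      map_smul' := fun c x => by
        ext n
        rcases n with _ | _ | n
        exacts [map_smul T _ _, map_smul X _ _, rfl] }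
    (1 + ‖T‖ + ‖X‖) fun x => by
      refine (sq_le_sq₀ (norm_nonneg _) (by positivity)).1 ?_
      refine (norm_liftSeq_sq T X x).trans_le ?_
      have h0 : ‖x 0‖ ≤ ‖x‖ := lp.norm_apply_le_norm two_ne_zero x 0
      have hT := pow_le_pow_left₀ (norm_nonneg _) (T.le_of_opNorm_le_of_le le_rfl h0) 2
      have hX := pow_le_pow_left₀ (norm_nonneg _) (X.le_of_opNorm_le_of_le le_rfl h0) 2
      nlinarith [sq_nonneg ‖x 0‖, mul_nonneg (norm_nonneg T) (sq_nonneg ‖x‖),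
        mul_nonneg (norm_nonneg X) (sq_nonneg ‖x‖),
        mul_nonneg (mul_nonneg (norm_nonneg T) (norm_nonneg X)) (sq_nonneg ‖x‖)]

variable [CompleteSpace H]

theorem inner_deltaOp_liftOp (T X : H →L[ℂ] H) (x y : lp (fun _ : ℕ => H) 2) :
    ⟪deltaOp (liftOp T X) x, y⟫_ℂ = ⟪(deltaOp T + star X * X) (x 0), y 0⟫_ℂ := by
  rw [inner_deltaOp_apply, add_apply, inner_add_left, inner_deltaOp_apply,
    ContinuousLinearMap.inner_star_mul_self_apply]
  have := inner_liftSeq T X x y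
  change ⟪liftOp T X x, liftOp T X y⟫_ℂ = _ at this
  rw [this]
  ring

/-- The isometric embedding of `H` as the zeroth coordinate of `ℓ²(ℕ, H)`. -/
noncomputable def singleZero : H →ₗᵢ[ℂ] lp (fun _ : ℕ => H) 2 where
  toLinearMap := lp.lsingle (𝕜 := ℂ) (E := fun _ : ℕ => H) 2 0
  norm_map' x := by
    have h : (0 : ENNReal) < 2 := by norm_num
    exact lp.norm_single (E := fun _ : ℕ => H) h 0 x

theorem adjoint_singleZero_apply (x : lp (fun _ : ℕ => H) 2) :
    adjoint (singleZero : H →ₗᵢ[ℂ] lp (fun _ : ℕ => H) 2).toContinuousLinearMap x = x 0 :=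
  ext_inner_right ℂ fun y => by
    rw [ContinuousLinearMap.adjoint_inner_left]
    exact lp.inner_single_right (𝕜 := ℂ) (G := fun _ : ℕ => H) 0 y x

theorem isTwoIsometricLiftingTypeI_liftOp {T X : H →L[ℂ] H}
    (h : star T * (deltaOp T + star X * X) * T = deltaOp T + star X * X) :
    IsTwoIsometricLiftingTypeI singleZero T (liftOp T X) where
  isTwoIsometry := by
    refine ContinuousLinearMap.ext fun x => ext_inner_right ℂ fun y => ?_
    rw [← ContinuousLinearMap.star_eq_adjoint, ContinuousLinearMap.inner_star_mul_mul_apply,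
      inner_deltaOp_liftOp, inner_deltaOp_liftOp]
    conv_rhs => rw [← h, ContinuousLinearMap.inner_star_mul_mul_apply]
    rfl
  isLifting := by
    refine ContinuousLinearMap.ext fun x => ?_
    rw [ContinuousLinearMap.comp_apply, ContinuousLinearMap.comp_apply, adjoint_singleZero_apply,
      adjoint_singleZero_apply]
    rfl
  typeI := by
    intro x hx
    have hx0 : x 0 = 0 := by
      rw [← adjoint_singleZero_apply]
      refine ext_inner_right ℂ fun y => ?_
      rw [ContinuousLinearMap.adjoint_inner_left, inner_zero_left]
      exact (Submodule.mem_orthogonal' _ _).1 hx _ ⟨y, rfl⟩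
    refine ext_inner_right ℂ fun y => ?_
    refine (inner_deltaOp_liftOp T X x y).trans ?_
    rw [hx0, map_zero, inner_zero_left, inner_zero_left]

end Construction

theorem corollary4p4 {H : Type u} [NormedAddCommGroup H] [InnerProductSpace ℂ H]
    [CompleteSpace H] (T : H →L[ℂ] H) (hT : T ≠ 0) :
    HasTwoIsometricLiftingTypeI T ↔
      ∃ A Q : H →L[ℂ] H, 0 ≤ A ∧ 0 ≤ Q ∧ deltaOp T ≤ A ∧
        ContinuousLinearMap.adjoint T * A * T ≤ A ∧ A ≤ Q ∧
        Q ≤ ContinuousLinearMap.adjoint T * Q * T := by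
  constructor
  · rintro ⟨K, _, _, _, J, S, h⟩
    obtain ⟨A, hA, hTA, hfix⟩ := h.exists_fixed
    -- A fixed point serves as both `A` and `Q`.
    exact ⟨A, A, hA, hA, hTA, hfix.le, le_rfl, hfix.ge⟩
  · rintro ⟨A, Q, hA, -, hTA, hAT, hAQ, hQ⟩
    obtain ⟨Y, hAY, hY⟩ := ContinuousLinearMap.exists_le_star_mul_mul_eq_self hA hAT hAQ hQ
    obtain ⟨X, hX⟩ :=
      CStarAlgebra.nonneg_iff_eq_star_mul_self.1 (sub_nonneg.2 (hTA.trans hAY))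
    refine ⟨lp (fun _ : ℕ => H) 2, inferInstance, inferInstance, inferInstance, singleZero,
      liftOp T X, isTwoIsometricLiftingTypeI_liftOp ?_⟩
    rw [← hX, add_sub_cancel]
    exact hY
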